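/- All systems are finite-dimensional. For $\lambda>1$ and positive semidefinite matrices $\rho,\sigma$ (not necessarily of unit trace) let $$D_\lambda(\rho\|\sigma)=\frac{1}{\lambda-1}\ln\mathrm{Tr}\,\rho^{\lambda}\sigma^{1-\lambda}$$ be the Petz Rényi divergence, equal to $+\infty$ unless $\operatorname{supp}\rho\subseteq\operatorname{supp}\sigma$ (negative powers are taken on the support). For $\alpha\in[0,1]$ and $\beta\in(0,1]$ let $\mathbb{D}_\lambda(\alpha\|\beta)=D_\lambda(\alpha\Pi_0+(1-\alpha)\Pi_1\,\|\,\beta\Pi_0+(1/\beta-\beta)\Pi_1)$, where $\Pi_0=|0\rangle\langle 0|$ and $\Pi_1=|1\rangle\langle 1|$ are the coordinate projectors of a qubit. For a state $\rho^{AB}$ let $K_\lambda(A\rangle B)_\rho=\inf_{\sigma^B}D_\lambda(\rho^{AB}\|\mathbb{1}\otimes\sigma^B)$, the infimum being over all density matrices $\sigma^B$. For a quantum channel $\mathcal{M}^{X\to B}$, a state $\rho^{AX}$, $\rho^{AB}=(\mathrm{id}_A\otimes\mathcal{M})(\rho^{AX})$ and $s\in[-1/2,0)$, let $$E_0(s,\mathcal{M})_\rho=-\ln\mathrm{Tr}\Big[\mathrm{Tr}_A\big(\rho^{AB}\big)^{1/(s+1)}\Big]^{s+1}.$$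 Let $\mathcal{N}^{A'\to B}$ be a quantum channel (a completely positive trace preserving map) and $n\ge 1$. A protocol for entanglement transmission by $n$ uses of $\mathcal{N}$ consists of a pure state $|\phi\rangle^{AS}$ of a reference system $A$ and a system $S$ whose reduced state on $S$ is $\mathbb{1}/|S|$, an encoding channel $\mathcal{E}^{S\to A'^n}$ and a decoding channel $\mathcal{T}^{B^n\to\hat S}$ with $\hat S$ a copy of $S$. Put $\rho^{AA'^n}=\mathcal{E}(\phi^{AS})$, $\rho^{AB^n}=\mathcal{N}^{\otimes n}(\rho^{AA'^n})$ and $\rho^{A\hat S}=\mathcal{T}(\rho^{AB^n})$, all maps acting as the identity on $A$. The protocol is an $(n,\mathcal{R},1-\mathbb{F})$ code if $\mathcal{R}=\frac1n\ln|S|$ and $\langle\phi|\rho^{A\hat S}|\phi\rangle\ge\mathbb{F}$. Theorem. If $\mathbb{F}\ge e^{-n\mathcal{R}}$, then every $(n,\mathcal{R},1-\mathbb{F})$ code satisfies $$\mathbb{D}_\lambda(\mathbb{F}\|e^{-n\mathcal{R}})\le K_\lambda(A\rangle B^n)_\rho\qquad\text{for all }\lambda\in(1,2],$$ and $$\mathbb{F}\le\exp\big(sn\mathcal{R}-E_0(s,\mathcal{N}^{\otimes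 n})_\rho\big)\qquad\text{for all }s\in[-1/2,0),$$ where $E_0$ is taken at the state $\rho^{AA'^n}$. -/

import Mathlib

/- Finite-dimensional quantum systems are labelled by finite types: the system `a` has the Hilbert
space `ℂ^a` with its standard orthonormal basis, operators on it are complex matrices indexed by
`a`, and a joint system is labelled by the product of the labels. The `n`-fold system `a^n` is
labelled by `Fin n → a`. -/

namespace QInfo

open scoped ComplexOrder

/-- Density matrices: positive semidefinite matrices of unit trace. -/
def IsDensity {a : Type*} [Fintype a] (ρ : Matrix a a ℂ) : Prop :=
  ρ.PosSemidef ∧ ρ.trace = 1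

/-- The partial trace over the first of two systems. -/
def traceFst {a b : Type*} [Fintype a] (M : Matrix (a × b) (a × b) ℂ) : Matrix b b ℂ :=
  Matrix.of fun i j => ∑ x : a, M (x, i) (x, j)

/-- The map `id_r ⊗ Φ` on operators of a joint system: `Φ` acts on every block of a block matrix
whose blocks are indexed by `r`. -/
def ampliate (r : Type*) {a b : Type*} (Φ : Matrix a a ℂ →ₗ[ℂ] Matrix b b ℂ) :
    Matrix (r × a) (r × a) ℂ →ₗ[ℂ] Matrix (r × b) (r × b) ℂ where
  toFun M := Matrix.of fun x y => Φ (Matrix.of fun i j => M (x.1, i) (y.1, j)) x.2 y.2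
  map_add' M N := by
    ext x y
    exact congrFun (congrFun (Φ.map_add (Matrix.of fun i j => M (x.1, i) (y.1, j))
      (Matrix.of fun i j => N (x.1, i) (y.1, j))) x.2) y.2
  map_smul' c M := by
    ext x y
    exact congrFun (congrFun (Φ.map_smul c (Matrix.of fun i j => M (x.1, i) (y.1, j))) x.2) y.2

/-- A quantum channel (quantum operation): a completely positive, trace preserving linear map. -/
structure Channel (a b : Type*) [Fintype a] [Fintype b] where
  /-- the underlying linear map on operators -/
  map : Matrix a a ℂ →ₗ[ℂ] Matrix b b ℂ
  completelyPositive : ∀ (k : ℕ) (M : Matrix (Fin k × a) (Fin k × a) ℂ),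
    M.PosSemidef → (ampliate (Fin k) map M).PosSemidef
  tracePreserving : ∀ M : Matrix a a ℂ, (map M).trace = M.trace

/-- The tensor power `Φ^{⊗n}`, a map from operators on `a^n` to operators on `b^n`: it sends the
matrix unit `|x⟩⟨y| = ⨂ₖ |x k⟩⟨y k|` to `⨂ₖ Φ(|x k⟩⟨y k|)`. -/
def tensorPower (n : ℕ) {a b : Type*} [Fintype a] [DecidableEq a]
    (Φ : Matrix a a ℂ →ₗ[ℂ] Matrix b b ℂ) :
    Matrix (Fin n → a) (Fin n → a) ℂ →ₗ[ℂ] Matrix (Fin n → b) (Fin n → b) ℂ where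
  toFun M := Matrix.of fun u v =>
    ∑ x : Fin n → a, ∑ y : Fin n → a,
      M x y * ∏ k : Fin n, Φ (Matrix.single (x k) (y k) 1) (u k) (v k)
  map_add' M N := by
    ext u v
    simp [add_mul, Finset.sum_add_distrib]
  map_smul' c M := by
    ext u v
    simp [mul_assoc, Finset.mul_sum]

/-- The `t`-th power of a positive semidefinite matrix, by functional calculus on its spectrum.
Since `0 ^ t = 0` for real `t ≠ 0`, negative powers are taken on the support. -/
noncomputable def mpow {a : Type*} [Fintype a] [DecidableEq a] (ρ : Matrix a a ℂ) (t : ℝ) :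
    Matrix a a ℂ :=
  cfc (fun x : ℝ => x ^ t) ρ

open Classical in
/-- `Tr ρ^lam σ^(1 - lam)` for `lam > 1` and positive semidefinite `ρ`, `σ`. It is infinite unless
the support of `ρ` is contained in the support of `σ`. -/
noncomputable def renyiTrace {a : Type*} [Fintype a] [DecidableEq a] (lam : ℝ)
    (ρ σ : Matrix a a ℂ) : ENNReal :=
  if ∀ v : a → ℂ, σ.mulVec v = 0 → ρ.mulVec v = 0 then
    ENNReal.ofReal (mpow ρ lam * mpow σ (1 - lam)).trace.re
  else ⊤

/-- The (Petz) quantum Rényi divergence `D_lam(ρ ‖ σ) = (lam - 1)⁻¹ ln Tr ρ^lam σ^(1 - lam)` of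
order `lam > 1`, for positive semidefinite `ρ`, `σ` that need not have unit trace. -/
noncomputable def renyiDiv {a : Type*} [Fintype a] [DecidableEq a] (lam : ℝ)
    (ρ σ : Matrix a a ℂ) : EReal :=
  ((lam - 1)⁻¹ : ℝ) * ENNReal.log (renyiTrace lam ρ σ)

/-- The divergence `D_lam(ρ ‖ σ)` of `ρ = α Π₀ + (1 - α) Π₁` from `σ = β Π₀ + (1/β - β) Π₁`, where
`Π₀`, `Π₁` are the two coordinate projectors of a qubit, `α ∈ [0, 1]` and `β ∈ (0, 1]`. -/
noncomputable def binaryDiv (lam α β : ℝ) : EReal :=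
  renyiDiv lam (Matrix.diagonal ![(α : ℂ), ((1 - α : ℝ) : ℂ)])
    (Matrix.diagonal ![(β : ℂ), ((1 / β - β : ℝ) : ℂ)])

/-- `K_lam(A⟩B)_ρ`, the infimum of `D_lam(ρ^{AB} ‖ 𝟙 ⊗ σ^B)` over all density matrices `σ^B`. -/
noncomputable def condDiv {a b : Type*} [Fintype a] [DecidableEq a] [Fintype b] [DecidableEq b]
    (lam : ℝ) (ρ : Matrix (a × b) (a × b) ℂ) : EReal :=
  ⨅ (σ : Matrix b b ℂ) (_ : IsDensity σ),
    renyiDiv lam ρ (Matrix.kronecker (1 : Matrix a a ℂ) σ)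

/-- `E₀(s, Φ)_ρ = - ln Tr [Tr_A (ρ^{AB})^(1/(s+1))]^(s+1)` with `ρ^{AB} = (id_A ⊗ Φ)(ρ^{AX})`, for a
map `Φ` from operators on `x` to operators on `b` and a state `ρ` of the joint system `a × x`. -/
noncomputable def gallagerE0 {a x b : Type*} [Fintype a] [DecidableEq a] [Fintype b]
    [DecidableEq b] (s : ℝ) (Φ : Matrix x x ℂ →ₗ[ℂ] Matrix b b ℂ)
    (ρ : Matrix (a × x) (a × x) ℂ) : ℝ :=
  -Real.log (mpow (traceFst (mpow (ampliate a Φ ρ) (1 / (s + 1)))) (s + 1)).trace.re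

/-- A protocol for entanglement transmission by `n` independent uses of the channel `N`: a pure
state `φ` of the reference system `A` and the system `S` in which `S` is completely mixed, an
encoding operation from `S` to `X^n`, and a decoding operation from `Y^n` to a copy of `S`. -/
structure Protocol {X Y : Type*} [Fintype X] [Fintype Y] (N : Channel X Y) (n : ℕ)
    (A S : Type*) [Fintype A] [Fintype S] [DecidableEq S] where
  /-- the state vector shared between the reference and the sender -/
  φ : A × S → ℂ
  norm_φ : star φ ⬝ᵥ φ = 1
  mixed_φ : traceFst (Matrix.vecMulVec φ (star φ)) = (Fintype.card S : ℂ)⁻¹ • 1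
  /-- the encoding operation -/
  enc : Channel S (Fin n → X)
  /-- the decoding operation -/
  dec : Channel (Fin n → Y) S

namespace Protocol

variable {X Y : Type*} [Fintype X] [DecidableEq X] [Fintype Y] {N : Channel X Y} {n : ℕ}
  {A S : Type*} [Fintype A] [Fintype S] [DecidableEq S]

/-- The state of the reference and the `n` channel inputs after encoding. -/
def encoded (P : Protocol N n A S) : Matrix (A × (Fin n → X)) (A × (Fin n → X)) ℂ :=
  ampliate A P.enc.map (Matrix.vecMulVec P.φ (star P.φ))

/-- The state of the reference and the `n` channel outputs. -/
def received (P : Protocol N n A S) : Matrix (A × (Fin n → Y)) (A × (Fin n → Y)) ℂ :=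
  ampliate A (tensorPower n N.map) P.encoded

/-- The state of the reference and the receiver after decoding. -/
def decoded (P : Protocol N n A S) : Matrix (A × S) (A × S) ℂ :=
  ampliate A P.dec.map P.received

/-- The fidelity `⟨φ| ρ |φ⟩` of the decoded state `ρ` with the original state `φ`. -/
noncomputable def fidelity (P : Protocol N n A S) : ℝ :=
  (star P.φ ⬝ᵥ P.decoded.mulVec P.φ).re

/-- `P` is an `(n, R, ε)` code: its communication rate `ln |S| / n` is `R`, and its fidelity is
not smaller than `1 - ε`. -/
def IsCode (P : Protocol N n A S) (R ε : ℝ) : Prop :=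
  R = Real.log (Fintype.card S) / n ∧ 1 - ε ≤ P.fidelity

end Protocol

end QInfo

namespace QInfo

open scoped ComplexOrder Kronecker
open Matrix

/-! Both bounds come from one binary test. Let Ψ = |φ⟩⟨φ|, let Q be `refProj φ` ⊗ 𝟙, and put β =
1/|S|. Since S is maximally mixed, `refProj φ` is a projector of rank |S|. Hence after decoding Q
has weight 1 on the received state and |S| = 1/β on 𝟙 ⊗ σ, whatever the density matrix σ, while Ψ
has weight at least F and exactly β. An effect E between 0 and Q that mixes Ψ and Q lowers the first
weight to exactly F and keeps the second at β. The pair E, Q - E then produces the two diagonal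
operators of the binary divergence (`binary_test_le`).

Monotonicity is needed only under such measurements (`sum_measured_rpow_le_trace`). For 1 < lam < 2
the function x^lam y^(1-lam) is an integral of quadratic perspectives x²/(x + ty), and lam = 2 is
itself one. For a quadratic perspective the matrix quantity dominates 2 Tr ρX - a Tr ρX² - b Tr σX²
for every Hermitian X; taking X = ∑ x_k Q_k and using X² ≤ ∑ x_k² Q_k gives the measured value.

The infimum over σ gives the first bound. For the second, lam = 1/(s+1), σ is the optimiser of
Sibson's identity (`exists_density_trace_eq`), and the nonnegative second term of the test is
dropped. -/

/-! ### Power perspectives as integrals of quadratic ones. -/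

lemma mul_rpowIntegrand_div {p t r s : ℝ} (hp : p ∈ Set.Ioo (0 : ℝ) 1) (ht : 0 < t) (hr : 0 ≤ r)
    (hs : 0 < s) :
    r * Real.rpowIntegrand₀₁ p t (r / s) = t ^ (p - 1) * (r ^ 2 / (1 * r + t * s)) := by
  rw [Real.rpowIntegrand₀₁_eq_pow_div hp ht.le (div_nonneg hr hs.le)]
  have : 0 < t + r / s := by positivity
  have : 0 < 1 * r + t * s := by positivity
  field_simp
  ring

/-- If all the quadratic perspectives `(x, y) ↦ x ^ 2 / (a * x + b * y)` compare, then so do the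
power perspectives `(x, y) ↦ x ^ lam * y ^ (1 - lam)` of order `1 < lam ≤ 2`. -/
lemma sum_rpow_perspective_le {ι κ : Type*} [Fintype ι] [Fintype κ] {p q : ι → ℝ} {r s w : κ → ℝ}
    (hp : ∀ k, 0 ≤ p k) (hq : ∀ k, 0 ≤ q k) (hr : ∀ e, 0 ≤ r e) (hs : ∀ e, 0 ≤ s e)
    (h0 : ∀ e, s e = 0 → r e * w e = 0)
    (h : ∀ a b : ℝ, 0 ≤ a → 0 < b →
      ∑ k, p k ^ 2 / (a * p k + b * q k) ≤ ∑ e, w e * (r e ^ 2 / (a * r e + b * s e)))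
    {lam : ℝ} (h1 : 1 < lam) (h2 : lam ≤ 2) :
    ∑ k, p k ^ lam * q k ^ (1 - lam) ≤ ∑ e, w e * (r e ^ lam * s e ^ (1 - lam)) := by
  rcases h2.eq_or_lt with rfl | h2
  -- The integral representation needs lam - 1 in (0, 1); at lam = 2 the claim is the quadratic case
  -- a = 0, b = 1.
  · have := h 0 1 le_rfl one_pos
    have e1 : (1 : ℝ) - 2 = -1 := by norm_num
    simpa only [zero_mul, one_mul, zero_add, e1, Real.rpow_neg_one, Real.rpow_two,
      div_eq_mul_inv] using this
  · have hl : lam - 1 ∈ Set.Ioo (0 : ℝ) 1 := ⟨by linarith, by linarith⟩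
    obtain ⟨μ, hμ⟩ := Real.exists_measure_rpow_eq_integral_rpowIntegrand₀₁ hl
    have key : ∀ x y : ℝ, 0 ≤ x → 0 ≤ y → x ^ lam * y ^ (1 - lam) =
        ∫ t in Set.Ioi 0, x * Real.rpowIntegrand₀₁ (lam - 1) t (x / y) ∂μ := by
      intro x y hx hy
      rw [MeasureTheory.integral_const_mul, ← (hμ _ (div_nonneg hx hy)).2, Real.div_rpow hx hy,
        div_eq_mul_inv, ← Real.rpow_neg hy, neg_sub, ← mul_assoc]
      congr 1
      rw [← Real.rpow_one_add' hx (by linarith)]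
      ring_nf
    have hint : ∀ x y : ℝ, 0 ≤ x → 0 ≤ y → MeasureTheory.IntegrableOn
        (fun t => x * Real.rpowIntegrand₀₁ (lam - 1) t (x / y)) (Set.Ioi 0) μ :=
      fun x y hx hy => (hμ _ (div_nonneg hx hy)).1.const_mul x
    simp_rw [fun k => key _ _ (hp k) (hq k), fun e => key _ _ (hr e) (hs e),
      ← MeasureTheory.integral_const_mul]
    rw [← MeasureTheory.integral_finsetSum _ fun k _ => hint _ _ (hp k) (hq k),
      ← MeasureTheory.integral_finsetSum _ fun e _ => (hint _ _ (hr e) (hs e)).const_mul (w e)]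
    refine MeasureTheory.setIntegral_mono_on
      (MeasureTheory.integrable_finsetSum _ fun k _ => hint _ _ (hp k) (hq k))
      (MeasureTheory.integrable_finsetSum _ fun e _ => (hint _ _ (hr e) (hs e)).const_mul (w e))
      measurableSet_Ioi fun t ht => ?_
    have ht : 0 < t := ht
    calc _ ≤ ∑ k, t ^ (lam - 1 - 1) * (p k ^ 2 / (1 * p k + t * q k)) := by
            refine Finset.sum_le_sum fun k _ => ?_
            rcases (hq k).eq_or_lt with hk | hk
            -- By the convention x / 0 = 0 the left term is 0 here, which is harmless in an upper
            -- bound.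
            · have := hp k
              rw [← hk, div_zero, Real.rpowIntegrand₀₁_zero_right, mul_zero]
              positivity
            · exact (mul_rpowIntegrand_div hl ht (hp k) hk).le
      _ ≤ t ^ (lam - 1 - 1) * ∑ e, w e * (r e ^ 2 / (1 * r e + t * s e)) := by
            rw [← Finset.mul_sum]
            exact mul_le_mul_of_nonneg_left (h 1 t zero_le_one ht) (by positivity)
      _ = _ := by
            rw [Finset.mul_sum]
            refine Finset.sum_congr rfl fun e _ => ?_
            rcases (hs e).eq_or_lt with he | he
            -- On this side a term lost to division by zero would matter; the support condition `h0`
            -- makes it vanish.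
            · have := h0 e he.symm
              rw [← he, div_zero, Real.rpowIntegrand₀₁_zero_right]
              rcases mul_eq_zero.1 this with h | h <;> simp [h]
            · rw [mul_rpowIntegrand_div hl ht (hr e) he]
              ring

/-! ### Monotonicity of Tr ρ^lam σ^(1-lam) under measurements. -/

section Measurement

variable {m : Type*} [Fintype m]

open scoped MatrixOrder in
lemma exists_eq_conjTranspose_mul_self {A : Matrix m m ℂ} (hA : A.PosSemidef) :
    ∃ B : Matrix m m ℂ, A = Bᴴ * B := by
  classical
  exact CStarAlgebra.nonneg_iff_eq_star_mul_self.mp hA.nonneg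

lemma trace_mul_re_nonneg {A B : Matrix m m ℂ} (hA : A.PosSemidef) (hB : B.PosSemidef) :
    0 ≤ (A * B).trace.re := by
  obtain ⟨C, rfl⟩ := exists_eq_conjTranspose_mul_self hA
  rw [trace_mul_cycle, trace_mul_cycle]
  exact (Complex.nonneg_iff.1 (hB.mul_mul_conjTranspose_same C).trace_nonneg).1

/-- Operator Jensen inequality for the square: with X = ∑ x_k Q_k the difference equals ∑ (x_k - X)
Q_k (x_k - X) + X (1 - ∑ Q_k) X. The effects need not sum to 1. -/
lemma posSemidef_sum_smul_sub_sq [DecidableEq m] {ι : Type*} [Fintype ι] {Q : ι → Matrix m m ℂ}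
    (hQ : ∀ k, (Q k).PosSemidef) (hQ1 : (1 - ∑ k, Q k).PosSemidef) (x : ι → ℝ) :
    (∑ k, (x k ^ 2) • Q k - (∑ k, x k • Q k) * ∑ k, x k • Q k).PosSemidef := by
  set X := ∑ k, x k • Q k with hX
  have hXh : Xᴴ = X := by
    rw [hX, conjTranspose_sum]
    exact Finset.sum_congr rfl fun k _ => by
      rw [conjTranspose_smul, (hQ k).1.eq, star_trivial]
  have key : ∑ k, (x k ^ 2) • Q k - X * X =
      ∑ k, (x k • (1 : Matrix m m ℂ) - X)ᴴ * Q k * (x k • (1 : Matrix m m ℂ) - X)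
        + Xᴴ * (1 - ∑ k, Q k) * X := by
    have e : ∀ k, (x k • (1 : Matrix m m ℂ) - X)ᴴ * Q k * (x k • (1 : Matrix m m ℂ) - X) =
        (x k ^ 2) • Q k - (x k • Q k) * X - X * (x k • Q k) + X * Q k * X := by
      intro k
      rw [conjTranspose_sub, conjTranspose_smul, hXh, conjTranspose_one, star_trivial]
      simp only [sub_mul, mul_sub, smul_mul_assoc, mul_smul_comm, one_mul, mul_one, smul_sub,
        smul_smul, pow_two]
      abel
    simp_rw [e, Finset.sum_add_distrib, Finset.sum_sub_distrib, ← Finset.sum_mul,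
      ← Finset.mul_sum, ← hX, hXh]
    noncomm_ring
  rw [key]
  exact (posSemidef_sum _ fun k _ => (hQ k).conjTranspose_mul_mul_same _).add
    (hQ1.conjTranspose_mul_mul_same X)

variable [DecidableEq m]

lemma mpow_eq {ρ : Matrix m m ℂ} (h : ρ.IsHermitian) (t : ℝ) :
    mpow ρ t = (h.eigenvectorUnitary : Matrix m m ℂ) *
      diagonal (fun i => ((h.eigenvalues i ^ t : ℝ) : ℂ)) *
        (h.eigenvectorUnitary : Matrix m m ℂ)ᴴ := by
  rw [mpow, h.cfc_eq]
  rfl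

lemma eq_eigenvectorUnitary_mul {ρ : Matrix m m ℂ} (h : ρ.IsHermitian) :
    ρ = (h.eigenvectorUnitary : Matrix m m ℂ) *
      diagonal (fun i => ((h.eigenvalues i : ℝ) : ℂ)) *
        (h.eigenvectorUnitary : Matrix m m ℂ)ᴴ :=
  h.spectral_theorem

lemma conjTranspose_mul_eigenvectorUnitary {ρ : Matrix m m ℂ} (h : ρ.IsHermitian) :
    (h.eigenvectorUnitary : Matrix m m ℂ)ᴴ * (h.eigenvectorUnitary : Matrix m m ℂ) = 1 :=
  Unitary.coe_star_mul_self _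

lemma eigenvectorUnitary_mul_conjTranspose {ρ : Matrix m m ℂ} (h : ρ.IsHermitian) :
    (h.eigenvectorUnitary : Matrix m m ℂ) * (h.eigenvectorUnitary : Matrix m m ℂ)ᴴ = 1 :=
  Unitary.coe_mul_star_self _

/-- The overlaps `⟨i|j⟩` of the eigenvectors of two Hermitian matrices. -/
noncomputable def overlap {ρ σ : Matrix m m ℂ} (h : ρ.IsHermitian) (h' : σ.IsHermitian) :
    Matrix m m ℂ :=
  (h.eigenvectorUnitary : Matrix m m ℂ)ᴴ * (h'.eigenvectorUnitary : Matrix m m ℂ)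

lemma trace_diagonal_mul_mul_diagonal_mul_re (d e : m → ℝ) (G : Matrix m m ℂ) :
    (diagonal (fun i => (d i : ℂ)) * (G * diagonal (fun i => (e i : ℂ)) * Gᴴ)).trace.re =
      ∑ x : m × m, Complex.normSq (G x.1 x.2) * (d x.1 * e x.2) := by
  rw [Fintype.sum_prod_type, trace, Complex.re_sum]
  refine Finset.sum_congr rfl fun i _ => ?_
  rw [diag_apply, diagonal_mul, Complex.re_ofReal_mul, mul_apply, Complex.re_sum, Finset.mul_sum]
  refine Finset.sum_congr rfl fun j _ => ?_
  simp only [mul_diagonal, conjTranspose_apply, RCLike.star_def, Complex.normSq_apply,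
    Complex.mul_re, Complex.mul_im, Complex.conj_re, Complex.conj_im, Complex.ofReal_re,
    Complex.ofReal_im]
  ring

lemma trace_mpow_mul_mpow_re {ρ σ : Matrix m m ℂ} (h : ρ.IsHermitian) (h' : σ.IsHermitian)
    (s t : ℝ) : (mpow ρ s * mpow σ t).trace.re =
      ∑ x : m × m, Complex.normSq (overlap h h' x.1 x.2) *
        (h.eigenvalues x.1 ^ s * h'.eigenvalues x.2 ^ t) := by
  rw [← trace_diagonal_mul_mul_diagonal_mul_re (fun i => h.eigenvalues i ^ s)
    (fun i => h'.eigenvalues i ^ t) (overlap h h'), mpow_eq h, mpow_eq h', overlap,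
    conjTranspose_mul, conjTranspose_conjTranspose, Matrix.mul_assoc, Matrix.mul_assoc,
    trace_mul_comm]
  simp only [Matrix.mul_assoc]

/-- The support condition in eigenbases: a kernel eigenvector of σ is killed by ρ, hence orthogonal
to every eigenvector of ρ with nonzero eigenvalue. -/
lemma eigenvalue_mul_overlap {ρ σ : Matrix m m ℂ} (h : ρ.IsHermitian) (h' : σ.IsHermitian)
    (hsupp : ∀ v : m → ℂ, σ.mulVec v = 0 → ρ.mulVec v = 0) (i j : m)
    (hj : h'.eigenvalues j = 0) : (h.eigenvalues i : ℂ) * overlap h h' i j = 0 := by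
  set U : Matrix m m ℂ := ↑h.eigenvectorUnitary
  set W : Matrix m m ℂ := ↑h'.eigenvectorUnitary
  have e1 : σ * W = W * diagonal (fun i => ((h'.eigenvalues i : ℝ) : ℂ)) := by
    conv_lhs => rw [eq_eigenvectorUnitary_mul h']
    rw [Matrix.mul_assoc, conjTranspose_mul_eigenvectorUnitary, Matrix.mul_one]
  have e2 : Uᴴ * ρ = diagonal (fun i => ((h.eigenvalues i : ℝ) : ℂ)) * Uᴴ := by
    conv_lhs => rw [eq_eigenvectorUnitary_mul h]
    rw [← Matrix.mul_assoc, ← Matrix.mul_assoc, conjTranspose_mul_eigenvectorUnitary,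
      Matrix.one_mul]
  have h1 : ρ.mulVec (fun k => W k j) = 0 := by
    apply hsupp
    ext k
    have : (σ * W) k j = 0 := by rw [e1, mul_diagonal, hj]; simp
    exact this
  have h2 : (Uᴴ * (ρ * W)) i j = 0 := by
    rw [mul_apply]
    exact Finset.sum_eq_zero fun k _ => by
      have : (ρ * W) k j = 0 := congrFun h1 k
      rw [this, mul_zero]
  rw [← Matrix.mul_assoc, e2, Matrix.mul_assoc, diagonal_mul] at h2
  exact h2

lemma two_mul_sub_le_of_completing_square {c r : ℝ} (hc : 0 ≤ c) (y g : ℂ)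
    (h0 : c = 0 → (r : ℂ) * g = 0) :
    2 * (r * (y * star g).re) - c * Complex.normSq y ≤ Complex.normSq g * (r ^ 2 / c) := by
  simp only [Complex.normSq_apply, Complex.mul_re, RCLike.star_def, Complex.conj_re,
    Complex.conj_im]
  rcases hc.eq_or_lt with rfl | hc
  · have := h0 rfl
    rcases mul_eq_zero.1 this with h | h
    · have : r = 0 := by exact_mod_cast h
      simp [this]
    · simp [h]
  · rw [← sub_nonneg]
    have : (g.re * g.re + g.im * g.im) * (r ^ 2 / c) - (2 * (r * (y.re * g.re - y.im * -g.im))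
        - c * (y.re * y.re + y.im * y.im)) =
        ((r * g.re - c * y.re) ^ 2 + (r * g.im - c * y.im) ^ 2) / c := by
      field_simp
      ring
    rw [this]
    positivity

/-- The variational bound for the quadratic perspective of a pair of matrices. -/
lemma variational_le_sum {ρ σ : Matrix m m ℂ} (h : ρ.PosSemidef) (h' : σ.PosSemidef)
    (hsupp : ∀ v : m → ℂ, σ.mulVec v = 0 → ρ.mulVec v = 0) {X : Matrix m m ℂ} (hX : Xᴴ = X)
    {a b : ℝ} (ha : 0 ≤ a) (hb : 0 < b) :
    2 * (ρ * X).trace.re - a * (ρ * (X * X)).trace.re - b * (σ * (X * X)).trace.re ≤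
      ∑ x : m × m, Complex.normSq (overlap h.1 h'.1 x.1 x.2) *
        (h.1.eigenvalues x.1 ^ 2 / (a * h.1.eigenvalues x.1 + b * h'.1.eigenvalues x.2)) := by
  set U : Matrix m m ℂ := ↑h.1.eigenvectorUnitary with hU
  set W : Matrix m m ℂ := ↑h'.1.eigenvectorUnitary with hW
  have hUU : U * Uᴴ = 1 := eigenvectorUnitary_mul_conjTranspose h.1
  have hWW : W * Wᴴ = 1 := eigenvectorUnitary_mul_conjTranspose h'.1
  set D : Matrix m m ℂ := diagonal (fun i => ((h.1.eigenvalues i : ℝ) : ℂ)) with hD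
  set E : Matrix m m ℂ := diagonal (fun i => ((h'.1.eigenvalues i : ℝ) : ℂ)) with hE
  -- Rows in the eigenbasis of ρ and columns in that of σ turn all three traces into sums over the
  -- same index pairs, so the bound becomes a termwise completion of squares.
  set Y : Matrix m m ℂ := Uᴴ * X * W with hY
  have hYs : Yᴴ = Wᴴ * X * U := by
    simp only [hY, conjTranspose_mul, conjTranspose_conjTranspose, hX, Matrix.mul_assoc]
  have hρ : ρ = U * D * Uᴴ := eq_eigenvectorUnitary_mul h.1
  have hσ : σ = W * E * Wᴴ := eq_eigenvectorUnitary_mul h'.1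
  have t1 : (ρ * X).trace = (D * (Y * (overlap h.1 h'.1)ᴴ)).trace := by
    have : Y * (overlap h.1 h'.1)ᴴ = Uᴴ * X * U := by
      rw [overlap, conjTranspose_mul, conjTranspose_conjTranspose, ← hU, ← hW, hY,
        Matrix.mul_assoc, ← Matrix.mul_assoc W, hWW, Matrix.one_mul]
    rw [this, hρ, Matrix.mul_assoc, Matrix.mul_assoc, trace_mul_comm]
    simp only [Matrix.mul_assoc]
  have t2 : (ρ * (X * X)).trace = (D * (Y * Yᴴ)).trace := by
    have : Y * Yᴴ = Uᴴ * (X * X) * U := by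
      rw [hYs, hY, Matrix.mul_assoc, ← Matrix.mul_assoc W, ← Matrix.mul_assoc W, hWW,
        Matrix.one_mul]
      simp only [Matrix.mul_assoc]
    rw [this, hρ, Matrix.mul_assoc, Matrix.mul_assoc, trace_mul_comm]
    simp only [Matrix.mul_assoc]
  have t3 : (σ * (X * X)).trace = (E * (Yᴴ * Y)).trace := by
    have : Yᴴ * Y = Wᴴ * (X * X) * W := by
      rw [hYs, hY, Matrix.mul_assoc, ← Matrix.mul_assoc U, ← Matrix.mul_assoc U, hUU,
        Matrix.one_mul]
      simp only [Matrix.mul_assoc]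
    rw [this, hσ, Matrix.mul_assoc, Matrix.mul_assoc, trace_mul_comm]
    simp only [Matrix.mul_assoc]
  have s1 : (ρ * X).trace.re = ∑ x : m × m, h.1.eigenvalues x.1 *
      (Y x.1 x.2 * star (overlap h.1 h'.1 x.1 x.2)).re := by
    rw [t1, Fintype.sum_prod_type, trace, Complex.re_sum]
    refine Finset.sum_congr rfl fun i _ => ?_
    rw [diag_apply, hD, diagonal_mul, Complex.re_ofReal_mul, mul_apply, Complex.re_sum,
      Finset.mul_sum]
    rfl
  have s2 : (ρ * (X * X)).trace.re = ∑ x : m × m, h.1.eigenvalues x.1 *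
      Complex.normSq (Y x.1 x.2) := by
    have := trace_diagonal_mul_mul_diagonal_mul_re h.1.eigenvalues (fun _ => 1) Y
    simp only [Complex.ofReal_one, diagonal_one, mul_one] at this
    rw [t2, this]
    exact Finset.sum_congr rfl fun x _ => mul_comm _ _
  have s3 : (σ * (X * X)).trace.re = ∑ x : m × m, h'.1.eigenvalues x.2 *
      Complex.normSq (Y x.1 x.2) := by
    have := trace_diagonal_mul_mul_diagonal_mul_re (fun _ => 1) h'.1.eigenvalues Y
    simp only [Complex.ofReal_one, diagonal_one, one_mul] at this
    rw [t3, ← Matrix.mul_assoc, trace_mul_cycle, this]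
    exact Finset.sum_congr rfl fun x _ => mul_comm _ _
  rw [s1, s2, s3, Finset.mul_sum, Finset.mul_sum, Finset.mul_sum, ← Finset.sum_sub_distrib,
    ← Finset.sum_sub_distrib]
  refine Finset.sum_le_sum fun x _ => ?_
  have hr := h.eigenvalues_nonneg x.1
  have hs := h'.eigenvalues_nonneg x.2
  refine le_trans (le_of_eq ?_) (two_mul_sub_le_of_completing_square
    (c := a * h.1.eigenvalues x.1 + b * h'.1.eigenvalues x.2) (by positivity) (Y x.1 x.2) _ ?_)
  · ring
  · intro hc
    refine eigenvalue_mul_overlap h.1 h'.1 hsupp _ _ ?_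
    have h1 : 0 ≤ a * h.1.eigenvalues x.1 := by positivity
    nlinarith

/-- The trace `Tr ρ^lam σ^(1-lam)`, for `1 < lam ≤ 2`, does not increase under measurements. -/
theorem sum_measured_rpow_le_trace {ρ σ : Matrix m m ℂ} (h : ρ.PosSemidef) (h' : σ.PosSemidef)
    (hsupp : ∀ v : m → ℂ, σ.mulVec v = 0 → ρ.mulVec v = 0) {ι : Type*} [Fintype ι]
    {Q : ι → Matrix m m ℂ} (hQ : ∀ k, (Q k).PosSemidef) (hQ1 : (1 - ∑ k, Q k).PosSemidef)
    {lam : ℝ} (h1 : 1 < lam) (h2 : lam ≤ 2) :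
    ∑ k, (ρ * Q k).trace.re ^ lam * (σ * Q k).trace.re ^ (1 - lam) ≤
      (mpow ρ lam * mpow σ (1 - lam)).trace.re := by
  rw [trace_mpow_mul_mpow_re h.1 h'.1]
  refine sum_rpow_perspective_le (p := fun k => (ρ * Q k).trace.re)
    (q := fun k => (σ * Q k).trace.re) (r := fun e : m × m => h.1.eigenvalues e.1)
    (s := fun e : m × m => h'.1.eigenvalues e.2)
    (w := fun e : m × m => Complex.normSq (overlap h.1 h'.1 e.1 e.2))
    (fun k => trace_mul_re_nonneg h (hQ k)) (fun k => trace_mul_re_nonneg h' (hQ k))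
    (fun e => h.eigenvalues_nonneg _) (fun e => h'.eigenvalues_nonneg _) ?_ ?_ h1 h2
  · intro e he
    rcases mul_eq_zero.1 (eigenvalue_mul_overlap h.1 h'.1 hsupp e.1 e.2 he) with h0 | h0
    · rw [Complex.ofReal_eq_zero.1 h0, zero_mul]
    · rw [h0, map_zero, mul_zero]
  · intro a b ha hb
    set p : ι → ℝ := fun k => (ρ * Q k).trace.re with hp
    set q : ι → ℝ := fun k => (σ * Q k).trace.re with hq
    have hp0 : ∀ k, 0 ≤ p k := fun k => trace_mul_re_nonneg h (hQ k)
    have hq0 : ∀ k, 0 ≤ q k := fun k => trace_mul_re_nonneg h' (hQ k)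
    -- The maximiser of 2xp - x²(ap + bq), whose maximum is p²/(ap + bq).
    set x : ι → ℝ := fun k => p k / (a * p k + b * q k) with hx
    have hXh : (∑ k, x k • Q k)ᴴ = ∑ k, x k • Q k := by
      rw [conjTranspose_sum]
      exact Finset.sum_congr rfl fun k _ => by
        rw [conjTranspose_smul, (hQ k).1.eq, star_trivial]
    have tr : ∀ (τ : Matrix m m ℂ) (y : ι → ℝ),
        (τ * ∑ k, y k • Q k).trace.re = ∑ k, y k * (τ * Q k).trace.re := by
      intro τ y
      rw [Finset.mul_sum, trace_sum, Complex.re_sum]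
      exact Finset.sum_congr rfl fun k _ => by
        rw [mul_smul_comm, trace_smul, Complex.real_smul, Complex.re_ofReal_mul]
    have hsq := posSemidef_sum_smul_sub_sq hQ hQ1 x
    have b1 := trace_mul_re_nonneg h hsq
    have b2 := trace_mul_re_nonneg h' hsq
    rw [mul_sub, trace_sub, Complex.sub_re, tr] at b1 b2
    refine le_trans ?_ (variational_le_sum h h' hsupp hXh ha hb)
    rw [tr]
    have b3 : a * (ρ * ((∑ k, x k • Q k) * ∑ k, x k • Q k)).trace.re ≤
        a * ∑ k, x k ^ 2 * p k := mul_le_mul_of_nonneg_left (by linarith) ha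
    have b4 : b * (σ * ((∑ k, x k • Q k) * ∑ k, x k • Q k)).trace.re ≤
        b * ∑ k, x k ^ 2 * q k := mul_le_mul_of_nonneg_left (by linarith) hb.le
    have b5 : ∑ k, p k ^ 2 / (a * p k + b * q k) =
        2 * ∑ k, x k * p k - a * ∑ k, x k ^ 2 * p k - b * ∑ k, x k ^ 2 * q k := by
      rw [Finset.mul_sum, Finset.mul_sum, Finset.mul_sum, ← Finset.sum_sub_distrib,
        ← Finset.sum_sub_distrib]
      refine Finset.sum_congr rfl fun k _ => ?_
      have e : 2 * (x k * p k) - a * (x k ^ 2 * p k) - b * (x k ^ 2 * q k) =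
          2 * (x k * p k) - x k ^ 2 * (a * p k + b * q k) := by ring
      rw [e, hx]
      simp only
      rcases eq_or_ne (a * p k + b * q k) 0 with hc | hc
      · simp [hc]
      · field_simp
        ring
    linarith

end Measurement

/-! ### Kraus representations and arbitrary reference systems. -/

section Kraus

lemma ampliate_apply (r : Type*) {a b : Type*} (Φ : Matrix a a ℂ →ₗ[ℂ] Matrix b b ℂ)
    (M : Matrix (r × a) (r × a) ℂ) (x y : r × b) :
    ampliate r Φ M x y = Φ (Matrix.of fun i j => M (x.1, i) (y.1, j)) x.2 y.2 := rfl

lemma map_apply_eq_sum_single {a b : Type*} [Fintype a] [DecidableEq a] (Φ : Matrix a a ℂ →ₗ[ℂ] Matrix b b ℂ)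
    (M : Matrix a a ℂ) (u v : b) :
    Φ M u v = ∑ x, ∑ y, M x y * Φ (Matrix.single x y 1) u v := by
  conv_lhs => rw [matrix_eq_sum_single M]
  simp only [map_sum, Matrix.sum_apply]
  refine Finset.sum_congr rfl fun x _ => Finset.sum_congr rfl fun y _ => ?_
  have : Matrix.single x y (M x y) = M x y • Matrix.single x y (1 : ℂ) := by
    rw [smul_single, smul_eq_mul, mul_one]
  rw [this, map_smul, Matrix.smul_apply, smul_eq_mul]

variable {a b : Type*} [Fintype a] [Fintype b]

/-- The Kraus representation of a channel, on matrix units. -/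
lemma Channel.exists_kraus [DecidableEq a] (N : Channel a b) :
    ∃ K : Fin (Fintype.card a) × b → Matrix b a ℂ, ∀ x y u v,
      N.map (Matrix.single x y 1) u v = ∑ j, K j u x * star (K j v y) := by
  set e := (Fintype.equivFin a).symm
  -- The unnormalised maximally entangled vector; its image is the Choi matrix, and the rows of a
  -- factor B of Bᴴ B give the Kraus operators.
  set w : Fin (Fintype.card a) × a → ℂ := fun p => if e p.1 = p.2 then 1 else 0 with hw
  have hC := N.completelyPositive _ _ (posSemidef_vecMulVec_self_star w)
  obtain ⟨B, hB⟩ := exists_eq_conjTranspose_mul_self hC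
  refine ⟨fun j => Matrix.of fun u x => star (B j (e.symm x, u)), fun x y u v => ?_⟩
  have h := congrFun (congrFun hB (e.symm x, u)) (e.symm y, v)
  rw [ampliate_apply, mul_apply] at h
  have hs : (Matrix.of fun i j => vecMulVec w (star w) (e.symm x, i) (e.symm y, j)) =
      Matrix.single x y (1 : ℂ) := by
    ext i j
    simp only [hw, of_apply, vecMulVec_apply, Pi.star_apply, Equiv.apply_symm_apply, single_apply]
    by_cases h1 : x = i <;> by_cases h2 : y = j <;> simp [h1, h2]
  simp only [hs] at h
  rw [h]
  exact Finset.sum_congr rfl fun j _ => by simp [conjTranspose_apply]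

/-- The Kraus representation of an ampliation. -/
lemma ampliate_eq_sum_of_kraus {κ a b : Type*} [Fintype κ] [Fintype a] [DecidableEq a]
    {Φ : Matrix a a ℂ →ₗ[ℂ] Matrix b b ℂ}
    {K : κ → Matrix b a ℂ}
    (hK : ∀ x y u v, Φ (Matrix.single x y 1) u v = ∑ j, K j u x * star (K j v y))
    (r : Type*) [Fintype r] [DecidableEq r] (M : Matrix (r × a) (r × a) ℂ) :
    ampliate r Φ M = ∑ j, ((1 : Matrix r r ℂ) ⊗ₖ K j) * M * ((1 : Matrix r r ℂ) ⊗ₖ K j)ᴴ := by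
  ext ⟨p, u⟩ ⟨q, v⟩
  rw [ampliate_apply, map_apply_eq_sum_single]
  simp only [hK, of_apply, Matrix.sum_apply, mul_apply, kroneckerMap_apply, conjTranspose_apply,
    Fintype.sum_prod_type, one_apply, Finset.mul_sum, ite_mul, one_mul, zero_mul,
    apply_ite star, star_zero, mul_ite, mul_zero, Finset.sum_ite_eq, Finset.mem_univ,
    if_true, Finset.sum_mul, Finset.sum_ite_irrel, Finset.sum_const_zero]
  calc _ = ∑ y, ∑ x, ∑ j, M (p, x) (q, y) * (K j u x * star (K j v y)) := Finset.sum_comm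
    _ = ∑ y, ∑ j, ∑ x, M (p, x) (q, y) * (K j u x * star (K j v y)) :=
        Finset.sum_congr rfl fun y _ => Finset.sum_comm
    _ = ∑ j, ∑ y, ∑ x, M (p, x) (q, y) * (K j u x * star (K j v y)) := Finset.sum_comm
    _ = _ := by
        refine Finset.sum_congr rfl fun j _ => Finset.sum_congr rfl fun y _ => ?_
        refine Finset.sum_congr rfl fun x _ => ?_
        ring

/-- Complete positivity is defined with references `Fin k`; the Kraus form extends it to any finite
reference, and also applies to tensor powers. -/
lemma posSemidef_ampliate_of_kraus {κ : Type*} [Fintype κ] [DecidableEq a]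
    {Φ : Matrix a a ℂ →ₗ[ℂ] Matrix b b ℂ}
    {K : κ → Matrix b a ℂ}
    (hK : ∀ x y u v, Φ (Matrix.single x y 1) u v = ∑ j, K j u x * star (K j v y))
    (r : Type*) [Fintype r] {M : Matrix (r × a) (r × a) ℂ} (hM : M.PosSemidef) :
    (ampliate r Φ M).PosSemidef := by
  classical
  rw [ampliate_eq_sum_of_kraus hK]
  exact posSemidef_sum _ fun j _ => hM.mul_mul_conjTranspose_same _

end Kraus

/-! ### Tensor powers of channels. -/

section TensorPower

variable {a b : Type*} [Fintype a] [DecidableEq a]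

lemma tensorPower_single (n : ℕ) (Φ : Matrix a a ℂ →ₗ[ℂ] Matrix b b ℂ) (x y : Fin n → a)
    (u v : Fin n → b) : tensorPower n Φ (Matrix.single x y 1) u v =
      ∏ k, Φ (Matrix.single (x k) (y k) 1) (u k) (v k) := by
  simp only [tensorPower, LinearMap.coe_mk, AddHom.coe_mk, of_apply, single_apply, ite_and,
    ite_mul, one_mul, zero_mul]
  rw [Finset.sum_eq_single x, Finset.sum_eq_single y] <;> simp +contextual [eq_comm]

lemma tensorPower_kraus {κ : Type*} [Fintype κ] [Fintype b] (n : ℕ)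
    {Φ : Matrix a a ℂ →ₗ[ℂ] Matrix b b ℂ} {K : κ → Matrix b a ℂ}
    (hK : ∀ x y u v, Φ (Matrix.single x y 1) u v = ∑ j, K j u x * star (K j v y))
    (x y : Fin n → a) (u v : Fin n → b) : tensorPower n Φ (Matrix.single x y 1) u v =
      ∑ J : Fin n → κ, (Matrix.of fun u x => ∏ k, K (J k) (u k) (x k)) u x *
        star ((Matrix.of fun u x => ∏ k, K (J k) (u k) (x k)) v y) := by
  classical
  rw [tensorPower_single]
  simp only [hK, Finset.prod_univ_sum, Fintype.piFinset_univ, of_apply, star_prod,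
    Finset.prod_mul_distrib]

lemma trace_tensorPower [Fintype b] (n : ℕ) {Φ : Matrix a a ℂ →ₗ[ℂ] Matrix b b ℂ}
    (hΦ : ∀ M, (Φ M).trace = M.trace) (M : Matrix (Fin n → a) (Fin n → a) ℂ) :
    (tensorPower n Φ M).trace = M.trace := by
  classical
  have h1 : ∀ x y : Fin n → a, (tensorPower n Φ (Matrix.single x y 1)).trace =
      if x = y then 1 else 0 := by
    intro x y
    simp only [trace, diag_apply, tensorPower_single]
    rw [← Fintype.piFinset_univ, ← Finset.prod_univ_sum (fun _ => Finset.univ)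
      fun k j => Φ (Matrix.single (x k) (y k) 1) j j]
    have : ∀ k, ∑ j, Φ (Matrix.single (x k) (y k) 1) j j = if x k = y k then 1 else 0 := by
      intro k
      have := hΦ (Matrix.single (x k) (y k) 1)
      rw [trace] at this
      simp only [diag_apply] at this
      rw [this]
      split_ifs with h
      · rw [h, trace_single_eq_same]
      · rw [trace_single_eq_of_ne _ _ _ h]
    simp only [this, Finset.prod_ite_zero, Finset.prod_const_one, funext_iff, Finset.mem_univ,
      true_imp_iff]
  have h2 : (tensorPower n Φ M).trace =
      ∑ x, ∑ y, M x y * (tensorPower n Φ (Matrix.single x y 1)).trace := by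
    simp only [trace, diag_apply, Finset.mul_sum]
    simp_rw [fun u => map_apply_eq_sum_single (tensorPower n Φ) M u u]
    rw [Finset.sum_comm]
    exact Finset.sum_congr rfl fun x _ => Finset.sum_comm
  rw [h2]
  simp only [h1, mul_ite, mul_one, mul_zero, Finset.sum_ite_eq, Finset.mem_univ, if_true]
  rfl

end TensorPower

/-! ### Reference marginals and the Heisenberg picture. -/

section PartialTrace

lemma ampliate_one_kronecker {r a b : Type*} [DecidableEq r] (Φ : Matrix a a ℂ →ₗ[ℂ] Matrix b b ℂ)
    (σ : Matrix a a ℂ) :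
    ampliate r Φ ((1 : Matrix r r ℂ) ⊗ₖ σ) = (1 : Matrix r r ℂ) ⊗ₖ Φ σ := by
  ext ⟨p, u⟩ ⟨q, v⟩
  rw [ampliate_apply]
  have : (Matrix.of fun i j => ((1 : Matrix r r ℂ) ⊗ₖ σ) (p, i) (q, j)) =
      (1 : Matrix r r ℂ) p q • σ := rfl
  simp only [this, map_smul]
  rfl

variable {r a b : Type*} [Fintype r] [Fintype a] [Fintype b]

lemma trace_kronecker_one_mul [DecidableEq a] (G : Matrix r r ℂ) (M : Matrix (r × a) (r × a) ℂ) :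
    ((G ⊗ₖ (1 : Matrix a a ℂ)) * M).trace =
      ∑ x, ∑ y, G x y * (Matrix.of fun i j => M (y, i) (x, j)).trace := by
  simp only [trace, diag_apply, mul_apply, kroneckerMap_apply, Fintype.sum_prod_type, one_apply,
    mul_ite, mul_one, mul_zero, ite_mul, zero_mul, Finset.sum_ite_eq, Finset.mem_univ, if_true,
    of_apply, Finset.mul_sum]
  exact Finset.sum_congr rfl fun x _ => Finset.sum_comm

/-- Trace preservation on S leaves the reference marginal unchanged, so the weight of `refProj φ`
survives encoding, transmission and decoding. -/
lemma trace_kronecker_one_mul_ampliate [DecidableEq a] [DecidableEq b]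
    {Φ : Matrix a a ℂ →ₗ[ℂ] Matrix b b ℂ} (hΦ : ∀ M, (Φ M).trace = M.trace) (G : Matrix r r ℂ)
    (M : Matrix (r × a) (r × a) ℂ) :
    ((G ⊗ₖ (1 : Matrix b b ℂ)) * ampliate r Φ M).trace =
      ((G ⊗ₖ (1 : Matrix a a ℂ)) * M).trace := by
  rw [trace_kronecker_one_mul, trace_kronecker_one_mul]
  refine Finset.sum_congr rfl fun x _ => Finset.sum_congr rfl fun y _ => ?_
  rw [← hΦ]
  rfl

lemma trace_ampliate {Φ : Matrix a a ℂ →ₗ[ℂ] Matrix b b ℂ} (hΦ : ∀ M, (Φ M).trace = M.trace)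
    (M : Matrix (r × a) (r × a) ℂ) : (ampliate r Φ M).trace = M.trace := by
  classical
  have := trace_kronecker_one_mul_ampliate hΦ (1 : Matrix r r ℂ) M
  rwa [one_kronecker_one, one_kronecker_one, Matrix.one_mul, Matrix.one_mul] at this

/-- The Heisenberg picture of a channel acting on one part of a joint system. -/
lemma Channel.exists_dual_ampliate [DecidableEq a] [DecidableEq b] [DecidableEq r]
    (N : Channel a b) :
    ∃ D : Matrix (r × b) (r × b) ℂ → Matrix (r × a) (r × a) ℂ,
      (∀ M E, (M * D E).trace = (ampliate r N.map M * E).trace) ∧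
      (∀ E, E.PosSemidef → (D E).PosSemidef) ∧ D 1 = 1 ∧ ∀ E E', D (E - E') = D E - D E' := by
  obtain ⟨K, hK⟩ := N.exists_kraus
  let D : Matrix (r × b) (r × b) ℂ → Matrix (r × a) (r × a) ℂ := fun E =>
    ∑ j, ((1 : Matrix r r ℂ) ⊗ₖ K j)ᴴ * E * ((1 : Matrix r r ℂ) ⊗ₖ K j)
  have hD : ∀ M E, (M * D E).trace = (ampliate r N.map M * E).trace := by
    intro M E
    rw [ampliate_eq_sum_of_kraus hK, Finset.mul_sum, Finset.sum_mul, trace_sum, trace_sum]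
    refine Finset.sum_congr rfl fun j _ => ?_
    rw [← Matrix.mul_assoc, trace_mul_comm]
    simp only [Matrix.mul_assoc]
  refine ⟨D, hD, fun E hE => posSemidef_sum _ fun j _ => hE.conjTranspose_mul_mul_same _, ?_,
    fun E E' => ?_⟩
  -- Unitality of the dual is trace preservation of the channel.
  · refine ext_iff_trace_mul_left.2 fun M => ?_
    rw [hD, Matrix.mul_one, Matrix.mul_one, trace_ampliate N.tracePreserving]
  · refine ext_iff_trace_mul_left.2 fun M => ?_
    rw [hD, Matrix.mul_sub, Matrix.mul_sub, trace_sub, trace_sub, hD, hD]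

end PartialTrace

lemma posSemidef_of_isHermitian_of_mul_self {m : Type*} [Fintype m] {E : Matrix m m ℂ}
    (h : Eᴴ = E) (h2 : E * E = E) : E.PosSemidef := by
  have := posSemidef_conjTranspose_mul_self E
  rwa [h, h2] at this

/-! ### The binary test built from the maximally entangled state. -/

section Reference

variable {A S : Type*} [Fintype A] [Fintype S] [DecidableEq S] {φ : A × S → ℂ}

/-- The projector onto the support of the reduced state on `A` of a state vector `φ` of `A × S`
whose reduced state on `S` is completely mixed. -/
noncomputable def refProj (φ : A × S → ℂ) : Matrix A A ℂ :=
  (Fintype.card S : ℂ) • ((Matrix.of fun a s => φ (a, s)) * (Matrix.of fun a s => φ (a, s))ᴴ)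

lemma sum_mul_star_of_mixed
    (hφ : traceFst (vecMulVec φ (star φ)) = (Fintype.card S : ℂ)⁻¹ • 1) (i j : S) :
    ∑ a, φ (a, i) * star (φ (a, j)) = if i = j then (Fintype.card S : ℂ)⁻¹ else 0 := by
  have := congrFun (congrFun hφ i) j
  simpa [traceFst, vecMulVec_apply, Matrix.one_apply] using this

/-- Scaled by √|S|, the coefficient matrix of φ is an isometry from S to A; hence `refProj φ` has
rank |S| even when A is larger. -/
lemma conjTranspose_mul_self_of_mixed
    (hφ : traceFst (vecMulVec φ (star φ)) = (Fintype.card S : ℂ)⁻¹ • 1) :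
    (Matrix.of fun a s => φ (a, s))ᴴ * (Matrix.of fun a s => φ (a, s)) =
      (Fintype.card S : ℂ)⁻¹ • (1 : Matrix S S ℂ) := by
  ext i j
  have := sum_mul_star_of_mixed hφ j i
  simp only [mul_apply, conjTranspose_apply, of_apply, Matrix.smul_apply, one_apply, smul_eq_mul,
    mul_ite, mul_one, mul_zero]
  rw [if_congr eq_comm rfl rfl, ← this]
  exact Finset.sum_congr rfl fun a _ => mul_comm _ _

omit [Fintype A] [DecidableEq S] in
lemma conjTranspose_refProj : (refProj φ)ᴴ = refProj φ := by
  simp [refProj, conjTranspose_smul, conjTranspose_mul]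

variable [Nonempty S]

lemma refProj_mul_of
    (hφ : traceFst (vecMulVec φ (star φ)) = (Fintype.card S : ℂ)⁻¹ • 1) :
    refProj φ * (Matrix.of fun a s => φ (a, s)) = Matrix.of fun a s => φ (a, s) := by
  have hc : (Fintype.card S : ℂ) ≠ 0 := by simp
  rw [refProj, Matrix.smul_mul, Matrix.mul_assoc, conjTranspose_mul_self_of_mixed hφ,
    Matrix.mul_smul, Matrix.mul_one, smul_smul, mul_inv_cancel₀ hc, one_smul]

lemma refProj_mul_self
    (hφ : traceFst (vecMulVec φ (star φ)) = (Fintype.card S : ℂ)⁻¹ • 1) :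
    refProj φ * refProj φ = refProj φ := by
  conv_lhs => rw [refProj.eq_def φ, mul_smul_comm, ← Matrix.mul_assoc, ← refProj.eq_def φ,
    refProj_mul_of hφ]
  rfl

lemma trace_refProj
    (hφ : traceFst (vecMulVec φ (star φ)) = (Fintype.card S : ℂ)⁻¹ • 1) :
    (refProj φ).trace = Fintype.card S := by
  have hc : (Fintype.card S : ℂ) ≠ 0 := by simp
  rw [refProj, trace_smul, trace_mul_comm, conjTranspose_mul_self_of_mixed hφ, trace_smul,
    trace_one, smul_eq_mul, smul_eq_mul, inv_mul_cancel₀ hc, mul_one]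

lemma refProj_kronecker_mulVec
    (hφ : traceFst (vecMulVec φ (star φ)) = (Fintype.card S : ℂ)⁻¹ • 1) :
    (refProj φ ⊗ₖ (1 : Matrix S S ℂ)).mulVec φ = φ := by
  ext ⟨a, s⟩
  have := congrFun (congrFun (refProj_mul_of hφ) a) s
  rw [mul_apply] at this
  simp only [mulVec, dotProduct, kroneckerMap_apply, Fintype.sum_prod_type, one_apply, mul_ite,
    mul_one, mul_zero, ite_mul, zero_mul, Finset.sum_ite_eq, Finset.mem_univ, if_true]
  exact this

/-- The projector Ψ absorbs Q on both sides, so Q - Ψ is again a projector. -/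
lemma posSemidef_refProj_kronecker_sub
    (hn : star φ ⬝ᵥ φ = 1)
    (hφ : traceFst (vecMulVec φ (star φ)) = (Fintype.card S : ℂ)⁻¹ • 1) :
    (refProj φ ⊗ₖ (1 : Matrix S S ℂ) - vecMulVec φ (star φ)).PosSemidef := by
  have h1 : (refProj φ ⊗ₖ (1 : Matrix S S ℂ))ᴴ = refProj φ ⊗ₖ (1 : Matrix S S ℂ) := by
    rw [conjTranspose_kronecker, conjTranspose_refProj, conjTranspose_one]
  have h2 : (vecMulVec φ (star φ))ᴴ = vecMulVec φ (star φ) :=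
    (posSemidef_vecMulVec_self_star φ).1
  have h3 : (refProj φ ⊗ₖ (1 : Matrix S S ℂ)) * vecMulVec φ (star φ) = vecMulVec φ (star φ) := by
    rw [mul_vecMulVec, refProj_kronecker_mulVec hφ]
  have h4 : vecMulVec φ (star φ) * (refProj φ ⊗ₖ (1 : Matrix S S ℂ)) = vecMulVec φ (star φ) := by
    have := congrArg conjTranspose h3
    rwa [conjTranspose_mul, h1, h2] at this
  have h5 : vecMulVec φ (star φ) * vecMulVec φ (star φ) = vecMulVec φ (star φ) := by
    rw [vecMulVec_mul_vecMulVec, hn, one_smul]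
  refine posSemidef_of_isHermitian_of_mul_self (by rw [conjTranspose_sub, h1, h2]) ?_
  rw [Matrix.mul_sub, Matrix.sub_mul, Matrix.sub_mul, h3, h4, h5, ← mul_kronecker_mul,
    refProj_mul_self hφ, Matrix.one_mul, sub_self, sub_zero]

lemma posSemidef_one_sub_refProj_kronecker [DecidableEq A]
    (hφ : traceFst (vecMulVec φ (star φ)) = (Fintype.card S : ℂ)⁻¹ • 1) :
    (1 - refProj φ ⊗ₖ (1 : Matrix S S ℂ)).PosSemidef := by
  refine posSemidef_of_isHermitian_of_mul_self ?_ ?_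
  · rw [conjTranspose_sub, conjTranspose_kronecker, conjTranspose_refProj, conjTranspose_one,
      conjTranspose_one]
  · rw [Matrix.mul_sub, Matrix.sub_mul, Matrix.sub_mul, ← mul_kronecker_mul,
      refProj_mul_self hφ, Matrix.one_mul, Matrix.one_mul, Matrix.mul_one, Matrix.one_mul, sub_self,
      sub_zero]

-- The S-marginal of Ψ is 𝟙/|S|, which makes the weight of Ψ on 𝟙 ⊗ τ depend only on Tr τ.
omit [Nonempty S] in
lemma trace_one_kronecker_mul_vecMulVec [DecidableEq A]
    (hφ : traceFst (vecMulVec φ (star φ)) = (Fintype.card S : ℂ)⁻¹ • 1) (τ : Matrix S S ℂ) :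
    (((1 : Matrix A A ℂ) ⊗ₖ τ) * vecMulVec φ (star φ)).trace =
      (Fintype.card S : ℂ)⁻¹ * τ.trace := by
  rw [mul_vecMulVec, trace_vecMulVec]
  simp only [mulVec, dotProduct, kroneckerMap_apply, Fintype.sum_prod_type, one_apply, ite_mul,
    one_mul, zero_mul, Finset.sum_ite_irrel, Finset.sum_const_zero, Finset.sum_ite_eq,
    Finset.mem_univ, if_true, Finset.sum_mul, Pi.star_apply]
  calc _ = ∑ s, ∑ t, τ s t * ∑ a, φ (a, t) * star (φ (a, s)) := by
        rw [Finset.sum_comm]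
        refine Finset.sum_congr rfl fun s _ => ?_
        rw [Finset.sum_comm]
        refine Finset.sum_congr rfl fun t _ => ?_
        rw [Finset.mul_sum]
        exact Finset.sum_congr rfl fun a _ => mul_assoc _ _ _
    _ = _ := by
        simp only [sum_mul_star_of_mixed hφ, mul_ite, mul_zero, Finset.sum_ite_eq',
          Finset.mem_univ, if_true, trace, diag_apply, Finset.mul_sum]
        exact Finset.sum_congr rfl fun s _ => mul_comm _ _

lemma exists_convex_combination {c f x : ℝ} (h1 : c ≤ x) (h2 : x ≤ f) :
    ∃ θ : ℝ, 0 ≤ θ ∧ θ ≤ 1 ∧ θ * f + (1 - θ) * c = x := by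
  rcases (h1.trans h2).eq_or_lt with h | h
  · exact ⟨1, zero_le_one, le_rfl, by linarith⟩
  · refine ⟨(x - c) / (f - c), div_nonneg (by linarith) (by linarith),
      (div_le_one (by linarith)).2 (by linarith), ?_⟩
    have : f - c ≠ 0 := by linarith
    field_simp
    ring

/-- The binary test of a decoded state against a state vector `φ` whose reduced state is completely
mixed: the fidelity is at most one, and the test does not increase `Tr ρ^lam σ^(1-lam)`. -/
theorem binary_test_le [DecidableEq A] {Z : Type*} [Fintype Z] [DecidableEq Z]
    (hn : star φ ⬝ᵥ φ = 1)
    (hφ : traceFst (vecMulVec φ (star φ)) = (Fintype.card S : ℂ)⁻¹ • 1) (T : Channel Z S)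
    {ρ : Matrix (A × Z) (A × Z) ℂ} (hρ : ρ.PosSemidef)
    (hρ1 : ((refProj φ ⊗ₖ (1 : Matrix Z Z ℂ)) * ρ).trace = 1) {σ : Matrix Z Z ℂ}
    (hσ : IsDensity σ)
    (hsupp : ∀ v : A × Z → ℂ, ((1 : Matrix A A ℂ) ⊗ₖ σ).mulVec v = 0 → ρ.mulVec v = 0)
    {F : ℝ} (hF : (Fintype.card S : ℝ)⁻¹ ≤ F)
    (hf : F ≤ (ampliate A T.map ρ * vecMulVec φ (star φ)).trace.re)
    {lam : ℝ} (h1 : 1 < lam) (h2 : lam ≤ 2) :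
    F ^ lam * ((Fintype.card S : ℝ)⁻¹) ^ (1 - lam) +
      (1 - F) ^ lam * (Fintype.card S - (Fintype.card S : ℝ)⁻¹) ^ (1 - lam) ≤
      (mpow ρ lam * mpow ((1 : Matrix A A ℂ) ⊗ₖ σ) (1 - lam)).trace.re := by
  obtain ⟨D, hD, hDpos, hD1, hDsub⟩ := T.exists_dual_ampliate (r := A)
  set β : ℝ := (Fintype.card S : ℝ)⁻¹ with hβ
  have hc : (1 : ℝ) ≤ Fintype.card S := by exact_mod_cast Fintype.card_pos
  have hβ0 : 0 < β := inv_pos.2 (by linarith)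
  have hβ1 : β ≤ 1 := inv_le_one_of_one_le₀ hc
  set Ψ := vecMulVec φ (star φ) with hΨ
  set Q := refProj φ ⊗ₖ (1 : Matrix S S ℂ) with hQ
  have hΨpos : Ψ.PosSemidef := posSemidef_vecMulVec_self_star φ
  have hQΨ : (Q - Ψ).PosSemidef := posSemidef_refProj_kronecker_sub hn hφ
  have hQ1 : (1 - Q).PosSemidef := posSemidef_one_sub_refProj_kronecker hφ
  -- The fidelity may exceed F, so Ψ is mixed with β² Q. Both have weight β on the decoded 𝟙 ⊗ σ,
  -- since β² |S| = β, while on the decoded state their weights are the fidelity and β² ≤ F; θ tunes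
  -- the latter to exactly F.
  obtain ⟨θ, hθ0, hθ1, hθ⟩ := exists_convex_combination (c := β ^ 2) (by nlinarith) hf
  set E : Matrix (A × S) (A × S) ℂ := θ • Ψ + ((1 - θ) * β ^ 2) • Q with hE
  have hQpos : Q.PosSemidef := by
    have := hQΨ.add hΨpos
    rwa [sub_add_cancel] at this
  have hβ2 : β ^ 2 ≤ 1 := by nlinarith
  have hEpos : E.PosSemidef :=
    (hΨpos.smul hθ0).add (hQpos.smul (by have := sub_nonneg.2 hθ1; positivity))
  have hQE : (Q - E).PosSemidef := by
    have e : Q - E = (1 - (1 - θ) * β ^ 2) • (Q - Ψ) + ((1 - θ) * (1 - β ^ 2)) • Ψ := by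
      rw [hE]
      module
    rw [e]
    refine (hQΨ.smul ?_).add (hΨpos.smul ?_)
    · nlinarith
    · exact mul_nonneg (by linarith) (by linarith)
  have trE : ∀ M : Matrix (A × S) (A × S) ℂ, (M * E).trace.re =
      θ * (M * Ψ).trace.re + (1 - θ) * β ^ 2 * (M * Q).trace.re := by
    intro M
    rw [hE, Matrix.mul_add, mul_smul_comm, mul_smul_comm, trace_add, trace_smul, trace_smul,
      Complex.add_re, Complex.real_smul, Complex.real_smul, Complex.re_ofReal_mul,
      Complex.re_ofReal_mul]
  have trρQ : (ampliate A T.map ρ * Q).trace.re = 1 := by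
    rw [trace_mul_comm, trace_kronecker_one_mul_ampliate T.tracePreserving, hρ1, Complex.one_re]
  have trρE : (ampliate A T.map ρ * E).trace.re = F := by
    rw [trE, trρQ, mul_one, hθ]
  have trσQ : (ampliate A T.map ((1 : Matrix A A ℂ) ⊗ₖ σ) * Q).trace.re = Fintype.card S := by
    rw [ampliate_one_kronecker, ← mul_kronecker_mul, Matrix.one_mul, Matrix.mul_one,
      trace_kronecker, trace_refProj hφ, T.tracePreserving, hσ.2, mul_one, Complex.natCast_re]
  have trσΨ : (ampliate A T.map ((1 : Matrix A A ℂ) ⊗ₖ σ) * Ψ).trace.re = β := by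
    rw [ampliate_one_kronecker, trace_one_kronecker_mul_vecMulVec hφ, T.tracePreserving, hσ.2,
      mul_one, hβ, ← Complex.ofReal_natCast, ← Complex.ofReal_inv, Complex.ofReal_re]
  have trσE : (ampliate A T.map ((1 : Matrix A A ℂ) ⊗ₖ σ) * E).trace.re = β := by
    have : β * Fintype.card S = 1 := inv_mul_cancel₀ (by linarith)
    rw [trE, trσQ, trσΨ]
    linear_combination (1 - θ) * β * this
  -- The decoder is absorbed into the effects. They sum to D Q rather than 1, so the part outside Q
  -- is discarded.
  have key := sum_measured_rpow_le_trace hρ (PosSemidef.one.kronecker hσ.1) hsupp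
    (Q := ![D E, D (Q - E)]) (by
      intro k
      fin_cases k
      · exact hDpos _ hEpos
      · exact hDpos _ hQE) (by
      have : 1 - ∑ k, ![D E, D (Q - E)] k = D (1 - Q) := by
        rw [Fin.sum_univ_two, hDsub 1 Q, hD1]
        simp only [cons_val_zero, cons_val_one]
        rw [hDsub, add_sub_cancel]
      rw [this]
      exact hDpos _ hQ1) h1 h2
  rw [Fin.sum_univ_two] at key
  simpa only [cons_val_zero, cons_val_one, hD, Matrix.mul_sub, trace_sub, Complex.sub_re, trρQ,
    trρE, trσQ, trσE] using key

lemma trace_mul_vecMulVec_re_le_one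
    (hn : star φ ⬝ᵥ φ = 1)
    (hφ : traceFst (vecMulVec φ (star φ)) = (Fintype.card S : ℂ)⁻¹ • 1)
    {ρ : Matrix (A × S) (A × S) ℂ} (hρ : ρ.PosSemidef)
    (hρ1 : ((refProj φ ⊗ₖ (1 : Matrix S S ℂ)) * ρ).trace = 1) :
    (ρ * vecMulVec φ (star φ)).trace.re ≤ 1 := by
  have := trace_mul_re_nonneg hρ (posSemidef_refProj_kronecker_sub hn hφ)
  rw [Matrix.mul_sub, trace_sub, trace_mul_comm, hρ1, Complex.sub_re, Complex.one_re] at this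
  linarith

end Reference

/-! ### Real powers of matrices. -/

section FunctionalCalculus

variable {m : Type*} [Fintype m] [DecidableEq m]

lemma continuousOn_spectrum (ρ : Matrix m m ℂ) (f : ℝ → ℝ) : ContinuousOn f (spectrum ℝ ρ) :=
  finite_real_spectrum.continuousOn f

lemma nonneg_of_mem_spectrum {ρ : Matrix m m ℂ} (h : ρ.PosSemidef) {x : ℝ}
    (hx : x ∈ spectrum ℝ ρ) : 0 ≤ x := by
  rw [h.1.spectrum_real_eq_range_eigenvalues] at hx
  obtain ⟨i, rfl⟩ := hx
  exact h.eigenvalues_nonneg i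

/-- An entry of the eigenvector matrix is nonzero only where the diagonal entry equals the
eigenvalue, so it intertwines the powers as well. -/
lemma mpow_diagonal (d : m → ℝ) (t : ℝ) :
    mpow (diagonal fun i => (d i : ℂ)) t = diagonal fun i => ((d i ^ t : ℝ) : ℂ) := by
  have h : (diagonal fun i => (d i : ℂ)).IsHermitian := by
    refine isHermitian_diagonal_of_self_adjoint _ ?_
    ext i
    exact Complex.conj_ofReal _
  set U : Matrix m m ℂ := ↑h.eigenvectorUnitary with hU
  have h1 : diagonal (fun i => (d i : ℂ)) * U =
      U * diagonal (fun i => ((h.eigenvalues i : ℝ) : ℂ)) := by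
    conv_lhs => enter [1]; rw [eq_eigenvectorUnitary_mul h]
    rw [Matrix.mul_assoc, conjTranspose_mul_eigenvectorUnitary, Matrix.mul_one]
  have h2 : U * diagonal (fun i => ((h.eigenvalues i ^ t : ℝ) : ℂ)) =
      diagonal (fun i => ((d i ^ t : ℝ) : ℂ)) * U := by
    ext i j
    have := congrFun (congrFun h1 i) j
    rw [diagonal_mul, mul_diagonal] at this
    rw [diagonal_mul, mul_diagonal]
    rcases eq_or_ne (U i j) 0 with h0 | h0
    · rw [h0, zero_mul, mul_zero]
    · have e : (d i : ℂ) = (h.eigenvalues j : ℂ) :=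
        mul_right_cancel₀ h0 (this.trans (mul_comm _ _))
      rw [Complex.ofReal_injective e, mul_comm]
  rw [mpow_eq h, ← hU, h2, Matrix.mul_assoc, hU, eigenvectorUnitary_mul_conjTranspose,
    Matrix.mul_one]

/-- M ↦ 𝟙 ⊗ M is a continuous ⋆-homomorphism, hence commutes with the functional calculus. -/
lemma mpow_one_kronecker {a b : Type*} [Fintype a] [DecidableEq a] [Fintype b] [DecidableEq b]
    {σ : Matrix b b ℂ} (h : σ.IsHermitian) (t : ℝ) :
    mpow ((1 : Matrix a a ℂ) ⊗ₖ σ) t = (1 : Matrix a a ℂ) ⊗ₖ mpow σ t := by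
  let κ : Matrix b b ℂ →⋆ₐ[ℂ] Matrix (a × b) (a × b) ℂ :=
    { toFun := fun M => (1 : Matrix a a ℂ) ⊗ₖ M
      map_one' := one_kronecker_one
      map_mul' := fun M N => by rw [← mul_kronecker_mul, Matrix.one_mul]
      map_zero' := kronecker_zero _
      map_add' := fun M N => kronecker_add _ _ _
      commutes' := fun c => by
        rw [Algebra.algebraMap_eq_smul_one, Algebra.algebraMap_eq_smul_one, kronecker_smul,
          one_kronecker_one]
      map_star' := fun M => by
        rw [star_eq_conjTranspose, star_eq_conjTranspose, conjTranspose_kronecker,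
          conjTranspose_one] }
  have hκ : Continuous κ := κ.toAlgHom.toLinearMap.continuous_of_finiteDimensional
  have hs : IsSelfAdjoint σ := h
  exact (StarAlgHomClass.map_cfc (S := ℂ) κ (fun x : ℝ => x ^ t) σ (continuousOn_spectrum _ _)
    hκ hs (hs.map κ)).symm

lemma posSemidef_mpow {ρ : Matrix m m ℂ} (h : ρ.PosSemidef) (t : ℝ) : (mpow ρ t).PosSemidef := by
  rw [mpow_eq h.1]
  refine PosSemidef.mul_mul_conjTranspose_same (posSemidef_diagonal_iff.2 fun i => ?_) _
  exact_mod_cast Real.rpow_nonneg (h.eigenvalues_nonneg i) t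

lemma trace_mpow {ρ : Matrix m m ℂ} (h : ρ.IsHermitian) (t : ℝ) :
    (mpow ρ t).trace = ((∑ i, h.eigenvalues i ^ t : ℝ) : ℂ) := by
  rw [mpow_eq h, trace_mul_cycle, conjTranspose_mul_eigenvectorUnitary, Matrix.one_mul,
    trace_diagonal, Complex.ofReal_sum]

lemma trace_mpow_re_pos {ρ : Matrix m m ℂ} (h : ρ.PosSemidef) (hρ : 0 < ρ.trace.re) (t : ℝ) :
    0 < (mpow ρ t).trace.re := by
  rw [trace_mpow h.1, Complex.ofReal_re]
  rw [h.1.trace_eq_sum_eigenvalues, Complex.re_sum] at hρ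
  have hρ' : ∃ i, 0 < h.1.eigenvalues i := by
    by_contra! hn
    refine hρ.not_ge ?_
    exact Finset.sum_nonpos fun i _ => hn i
  obtain ⟨i, hi⟩ := hρ'
  exact Finset.sum_pos' (fun j _ => Real.rpow_nonneg (h.eigenvalues_nonneg j) t)
    ⟨i, Finset.mem_univ _, Real.rpow_pos_of_pos hi t⟩

/-- If `f x * g x = x` on the spectrum of `ρ`, then the kernel of `g(ρ)` lies in that of `ρ`. -/
lemma mulVec_eq_zero_of_cfc {ρ : Matrix m m ℂ} (h : ρ.PosSemidef) (f g : ℝ → ℝ)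
    (hfg : ∀ x, 0 ≤ x → f x * g x = x) {v : m → ℂ} (hv : (cfc g ρ).mulVec v = 0) :
    ρ.mulVec v = 0 := by
  have hs : IsSelfAdjoint ρ := h.1
  have : ρ = cfc f ρ * cfc g ρ := by
    rw [← cfc_mul f g ρ (continuousOn_spectrum _ _) (continuousOn_spectrum _ _)]
    conv_lhs => rw [← cfc_id' ℝ ρ]
    exact cfc_congr fun x hx => (hfg x (nonneg_of_mem_spectrum h hx)).symm
  rw [this, ← mulVec_mulVec, hv, mulVec_zero]

end FunctionalCalculus

/-! ### Partial traces and Sibson's identity. -/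

section PartialTrace

lemma posSemidef_traceFst {a b : Type*} [Fintype a] {M : Matrix (a × b) (a × b) ℂ} (h : M.PosSemidef) :
    (traceFst M).PosSemidef := by
  have : traceFst M = ∑ x : a, M.submatrix (fun i => (x, i)) fun i => (x, i) := by
    ext i j
    simp [traceFst, Matrix.sum_apply]
  rw [this]
  exact posSemidef_sum _ fun x _ => h.submatrix _

variable {a b : Type*} [Fintype a] [Fintype b]

lemma trace_traceFst (M : Matrix (a × b) (a × b) ℂ) : (traceFst M).trace = M.trace := by
  simp only [trace, traceFst, diag_apply, of_apply, Fintype.sum_prod_type]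
  exact Finset.sum_comm

lemma trace_mul_one_kronecker [DecidableEq a] (M : Matrix (a × b) (a × b) ℂ)
    (B : Matrix b b ℂ) :
    (M * ((1 : Matrix a a ℂ) ⊗ₖ B)).trace = (traceFst M * B).trace := by
  simp only [trace, traceFst, diag_apply, mul_apply, of_apply, kroneckerMap_apply, one_apply,
    Fintype.sum_prod_type, ite_mul, one_mul, zero_mul, mul_ite, mul_zero, Finset.sum_mul,
    Finset.sum_ite_irrel, Finset.sum_const_zero, Finset.sum_ite_eq', Finset.mem_univ, if_true]
  rw [Finset.sum_comm]
  exact Finset.sum_congr rfl fun i _ => Finset.sum_comm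

variable [DecidableEq a]

/-- The kernel of `𝟙 ⊗ σ` lies in the kernel of a positive semidefinite `M` as soon as the kernel
of `σ` lies in that of the partial trace of `M`. -/
lemma mulVec_eq_zero_of_traceFst {M : Matrix (a × b) (a × b) ℂ} (h : M.PosSemidef)
    {σ : Matrix b b ℂ} (hσ : ∀ w : b → ℂ, σ.mulVec w = 0 → (traceFst M).mulVec w = 0)
    {v : a × b → ℂ} (hv : ((1 : Matrix a a ℂ) ⊗ₖ σ).mulVec v = 0) : M.mulVec v = 0 := by
  -- `w y x` is e_y ⊗ v_x with v_x the x-th slice of v. Summing the quadratic form of M over y gives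
  -- that of the partial trace at v_x, which is 0; positivity kills each summand, and v = ∑ e_x ⊗
  -- v_x.
  let w : a → a → a × b → ℂ := fun y x p => if p.1 = y then v (x, p.2) else 0
  have h1 : ∀ x, σ.mulVec (fun i => v (x, i)) = 0 := by
    intro x
    ext i
    have := congrFun hv (x, i)
    simpa [mulVec, dotProduct, Fintype.sum_prod_type, one_apply] using this
  have h2 : ∀ x, ∑ y, star (w y x) ⬝ᵥ M.mulVec (w y x) = 0 := by
    intro x
    have h3 : star (fun i => v (x, i)) ⬝ᵥ (traceFst M).mulVec (fun i => v (x, i)) = 0 := by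
      rw [hσ _ (h1 x), dotProduct_zero]
    rw [← h3]
    simp only [w, dotProduct, mulVec, traceFst, of_apply, Pi.star_apply, Fintype.sum_prod_type,
      mul_ite, mul_zero, apply_ite star, star_zero, ite_mul, zero_mul, Finset.sum_ite_irrel,
      Finset.sum_const_zero, Finset.sum_ite_eq', Finset.mem_univ, if_true, Finset.sum_mul]
    rw [Finset.sum_comm]
    refine Finset.sum_congr rfl fun i _ => ?_
    rw [← Finset.mul_sum, Finset.sum_comm]
  have h4 : ∀ x, M.mulVec (w x x) = 0 := by
    intro x
    rw [← h.dotProduct_mulVec_zero_iff]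
    exact (Finset.sum_eq_zero_iff_of_nonneg fun y _ => h.dotProduct_mulVec_nonneg _).1 (h2 x) x
      (Finset.mem_univ x)
  have h5 : v = ∑ x, w x x := by
    ext ⟨x, i⟩
    simp [w, Finset.sum_apply]
  rw [h5, mulVec_sum]
  exact Finset.sum_eq_zero fun x _ => h4 x

variable [DecidableEq b]

/-- The quantum Sibson identity, as an upper bound: the normalised `1/lam`-th power of the partial
trace of `ρ ^ lam` is a candidate for the minimisation defining `condDiv`. -/
theorem exists_density_trace_eq {ρ : Matrix (a × b) (a × b) ℂ} (h : ρ.PosSemidef)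
    (hρ : 0 < ρ.trace.re) {lam : ℝ} (h1 : 1 < lam) :
    0 < (mpow (traceFst (mpow ρ lam)) (1 / lam)).trace.re ∧ ∃ σ : Matrix b b ℂ, IsDensity σ ∧
      (∀ v : a × b → ℂ, ((1 : Matrix a a ℂ) ⊗ₖ σ).mulVec v = 0 → ρ.mulVec v = 0) ∧
      (mpow ρ lam * mpow ((1 : Matrix a a ℂ) ⊗ₖ σ) (1 - lam)).trace.re =
        (mpow (traceFst (mpow ρ lam)) (1 / lam)).trace.re ^ lam := by
  have h0 : lam ≠ 0 := by linarith
  have hlam := posSemidef_mpow h lam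
  set τ := traceFst (mpow ρ lam) with hτ
  have hτpos : τ.PosSemidef := posSemidef_traceFst hlam
  have hτs : IsSelfAdjoint τ := hτpos.1
  set c := (mpow τ (1 / lam)).trace.re with hc
  have hc0 : 0 < c := by
    refine trace_mpow_re_pos hτpos ?_ _
    rw [hτ, trace_traceFst]
    exact trace_mpow_re_pos h hρ lam
  have hcc : (mpow τ (1 / lam)).trace = (c : ℂ) := by
    rw [hc, trace_mpow hτpos.1, Complex.ofReal_re]
  set g : ℝ → ℝ := fun x => c⁻¹ * x ^ (1 / lam) with hg
  have hgeq : cfc g τ = c⁻¹ • mpow τ (1 / lam) :=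
    cfc_const_mul c⁻¹ (fun x : ℝ => x ^ (1 / lam)) τ (continuousOn_spectrum _ _)
  have hgpos : (cfc g τ).PosSemidef := by
    rw [hgeq]
    exact (posSemidef_mpow hτpos _).smul (inv_nonneg.2 hc0.le)
  refine ⟨hc0, cfc g τ, ⟨hgpos, ?_⟩, fun v hv => ?_, ?_⟩
  · rw [hgeq, trace_smul, hcc, Complex.real_smul, ← Complex.ofReal_mul, inv_mul_cancel₀ hc0.ne',
      Complex.ofReal_one]
  · refine mulVec_eq_zero_of_cfc h (fun x => x ^ (1 - lam)) (fun x => x ^ lam) ?_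
      (mulVec_eq_zero_of_traceFst hlam (fun w hw => ?_) hv)
    · intro x hx
      rcases hx.eq_or_lt with rfl | hx
      · simp [Real.zero_rpow h0]
      · rw [← Real.rpow_add hx, sub_add_cancel, Real.rpow_one]
    · refine mulVec_eq_zero_of_cfc hτpos (fun x => c * x ^ (1 - 1 / lam)) g ?_ hw
      intro x hx
      rcases hx.eq_or_lt with rfl | hx
      · simp [hg, Real.zero_rpow (inv_ne_zero h0)]
      · have : x ^ (1 - 1 / lam) * x ^ (1 / lam) = x := by
          rw [← Real.rpow_add hx, sub_add_cancel, Real.rpow_one]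
        calc c * x ^ (1 - 1 / lam) * (c⁻¹ * x ^ (1 / lam)) =
              (c * c⁻¹) * (x ^ (1 - 1 / lam) * x ^ (1 / lam)) := by ring
          _ = x := by rw [this, mul_inv_cancel₀ hc0.ne', one_mul]
  · have e1 : mpow (cfc g τ) (1 - lam) = cfc (fun x => g x ^ (1 - lam)) τ := by
      refine (cfc_comp' (fun x : ℝ => x ^ (1 - lam)) g τ ?_ (continuousOn_spectrum _ _)).symm
      exact (finite_real_spectrum.image g).continuousOn _
    -- The exponents combine as 1 + (1 - lam)/lam = 1/lam; the trace is then c^(lam-1) · c = c^lam.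
    have e2 : τ * mpow (cfc g τ) (1 - lam) = c ^ (lam - 1) • mpow τ (1 / lam) := by
      rw [e1]
      conv_lhs => enter [1]; rw [← cfc_id' ℝ τ]
      rw [← cfc_mul _ _ τ (continuousOn_spectrum _ _) (continuousOn_spectrum _ _),
        mpow, ← cfc_const_mul _ _ τ (continuousOn_spectrum _ _)]
      refine cfc_congr fun x hx => ?_
      have hx := nonneg_of_mem_spectrum hτpos hx
      simp only [hg]
      rcases hx.eq_or_lt with rfl | hx
      · simp [Real.zero_rpow (inv_ne_zero h0)]
      · rw [Real.mul_rpow (by positivity) (by positivity), Real.inv_rpow hc0.le,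
          ← Real.rpow_neg hc0.le, neg_sub, ← Real.rpow_mul hx.le]
        have : x * x ^ (1 / lam * (1 - lam)) = x ^ (1 / lam) := by
          rw [← Real.rpow_one_add' hx.le]
          · congr 1
            field_simp
            ring
          · have : 1 + 1 / lam * (1 - lam) = 1 / lam := by
              field_simp
              ring
            rw [this]
            exact one_div_ne_zero h0
        rw [← this]
        ring
    rw [mpow_one_kronecker hgpos.1, trace_mul_one_kronecker, ← hτ, e2, trace_smul, hcc,
      Complex.real_smul, ← Complex.ofReal_mul, Complex.ofReal_re]
    nth_rewrite 2 [← Real.rpow_one c]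
    rw [← Real.rpow_add hc0, sub_add_cancel]

end PartialTrace

/-! ### From traces to divergences. -/

theorem binaryDiv_le_renyiDiv {m : Type*} [Fintype m] [DecidableEq m] {lam F β : ℝ}
    (h1 : 1 < lam) (hβ : 0 < β) (hF0 : β ≤ F) (hF : F ≤ 1) {ρ σ : Matrix m m ℂ}
    (h : (∀ v : m → ℂ, σ.mulVec v = 0 → ρ.mulVec v = 0) →
      F ^ lam * β ^ (1 - lam) + (1 - F) ^ lam * (1 / β - β) ^ (1 - lam) ≤
        (mpow ρ lam * mpow σ (1 - lam)).trace.re) :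
    binaryDiv lam F β ≤ renyiDiv lam ρ σ := by
  have e : ∀ x y : ℝ, (![(x : ℂ), (y : ℂ)] : Fin 2 → ℂ) = fun i => ((![x, y] i : ℝ) : ℂ) := by
    intro x y
    ext i
    fin_cases i <;> rfl
  have hl : (0 : EReal) ≤ ((lam - 1)⁻¹ : ℝ) := by
    exact_mod_cast inv_nonneg.2 (by linarith)
  refine mul_le_mul_of_nonneg_left (ENNReal.log_monotone ?_) hl
  unfold renyiTrace
  by_cases hs : ∀ v : m → ℂ, σ.mulVec v = 0 → ρ.mulVec v = 0
  · rw [if_pos hs, if_pos]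
    · refine ENNReal.ofReal_le_ofReal (le_trans (le_of_eq ?_) (h hs))
      rw [e, e, mpow_diagonal, mpow_diagonal, diagonal_mul_diagonal, trace_diagonal,
        Fin.sum_univ_two, ← Complex.ofReal_mul, ← Complex.ofReal_mul, ← Complex.ofReal_add,
        Complex.ofReal_re]
      rfl
    · intro v hv
      have h0 := congrFun hv 0
      have h1' := congrFun hv 1
      simp only [mulVec_diagonal, cons_val_zero, cons_val_one, Pi.zero_apply, mul_eq_zero,
        Complex.ofReal_eq_zero] at h0 h1'
      have hv0 : v 0 = 0 := h0.resolve_left hβ.ne'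
      ext i
      fin_cases i
      · simp [mulVec_diagonal, hv0]
      · rcases h1' with h2 | h2
        -- The second entry 1/β - β vanishes only at β = 1, where β ≤ F ≤ 1 forces F = 1, so the
        -- supports are still nested.
        · have : β = 1 := by
            rw [sub_eq_zero, div_eq_iff hβ.ne'] at h2
            nlinarith
          have : 1 - F = 0 := by linarith
          simp [mulVec_diagonal, this]
        · simp [mulVec_diagonal, h2]
  · rw [if_neg hs]
    exact le_top

/-! ### States and fidelity of a protocol. -/

namespace Protocol

variable {X Y : Type*} [Fintype X] [DecidableEq X] [Fintype Y]
  {N : Channel X Y} {n : ℕ} {A S : Type*} [Fintype A] [Fintype S] [DecidableEq S]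
  (P : Protocol N n A S)

lemma nonempty {X Y : Type*} [Fintype X] [Fintype Y] {N : Channel X Y} {n : ℕ} {A S : Type*}
    [Fintype A] [Fintype S] [DecidableEq S] (P : Protocol N n A S) : Nonempty S := by
  by_contra h
  rw [not_nonempty_iff] at h
  have := P.norm_φ
  simp [dotProduct] at this

lemma posSemidef_received : P.received.PosSemidef := by
  obtain ⟨K, hK⟩ := N.exists_kraus
  obtain ⟨K', hK'⟩ := P.enc.exists_kraus
  exact posSemidef_ampliate_of_kraus (tensorPower_kraus n hK) A
    (posSemidef_ampliate_of_kraus hK' A (posSemidef_vecMulVec_self_star P.φ))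

lemma trace_refProj_kronecker_mul_received [DecidableEq Y] :
    ((refProj P.φ ⊗ₖ (1 : Matrix (Fin n → Y) (Fin n → Y) ℂ)) * P.received).trace = 1 := by
  have := P.nonempty
  rw [received, trace_kronecker_one_mul_ampliate (trace_tensorPower n N.tracePreserving), encoded,
    trace_kronecker_one_mul_ampliate P.enc.tracePreserving, mul_vecMulVec,
    refProj_kronecker_mulVec P.mixed_φ, trace_vecMulVec, dotProduct_comm, P.norm_φ]

lemma trace_received : P.received.trace = 1 := by
  rw [received, trace_ampliate (trace_tensorPower n N.tracePreserving), encoded,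
    trace_ampliate P.enc.tracePreserving, trace_vecMulVec, dotProduct_comm, P.norm_φ]

lemma fidelity_eq :
    P.fidelity = (P.decoded * vecMulVec P.φ (star P.φ)).trace.re := by
  rw [fidelity, mul_vecMulVec, trace_vecMulVec, dotProduct_comm]

lemma fidelity_le_one : P.fidelity ≤ 1 := by
  classical
  have := P.nonempty
  obtain ⟨K, hK⟩ := P.dec.exists_kraus
  rw [fidelity_eq]
  refine trace_mul_vecMulVec_re_le_one P.norm_φ P.mixed_φ
    (posSemidef_ampliate_of_kraus hK A P.posSemidef_received) ?_
  rw [decoded, trace_kronecker_one_mul_ampliate P.dec.tracePreserving,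
    trace_refProj_kronecker_mul_received]

end Protocol

end QInfo

/-! ### The converse bounds. -/

theorem theorem1 {X Y A S : Type*} [Fintype X] [DecidableEq X] [Fintype Y] [DecidableEq Y]
    [Fintype A] [DecidableEq A] [Fintype S] [DecidableEq S]
    (N : QInfo.Channel X Y) (n : ℕ) (hn : 0 < n) (R F : ℝ)
    (P : QInfo.Protocol N n A S) (hP : P.IsCode R (1 - F))
    (hF : Real.exp (-(n * R)) ≤ F) :
    (∀ lam : ℝ, 1 < lam → lam ≤ 2 →
      QInfo.binaryDiv lam F (Real.exp (-(n * R))) ≤ QInfo.condDiv lam P.received) ∧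
    (∀ s : ℝ, -(1 / 2) ≤ s → s < 0 →
      F ≤ Real.exp (s * n * R -
        QInfo.gallagerE0 s (QInfo.tensorPower n N.map) P.encoded)) := by
  have hS := P.nonempty
  have hcard : (0 : ℝ) < Fintype.card S := by exact_mod_cast Fintype.card_pos
  have hnR : n * R = Real.log (Fintype.card S) := by
    have : (n : ℝ) ≠ 0 := by exact_mod_cast hn.ne'
    rw [hP.1]
    field_simp
  have hβ : Real.exp (-(n * R)) = (Fintype.card S : ℝ)⁻¹ := by
    rw [hnR, Real.exp_neg, Real.exp_log hcard]
  have hf : F ≤ P.fidelity := by linarith [hP.2]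
  have hF1 : F ≤ 1 := hf.trans P.fidelity_le_one
  rw [P.fidelity_eq] at hf
  rw [hβ] at hF ⊢
  have hF0 : 0 < F := (inv_pos.2 hcard).trans_le hF
  have test := fun (lam : ℝ) (h1 : 1 < lam) (h2 : lam ≤ 2) (σ : Matrix (Fin n → Y) (Fin n → Y) ℂ)
    (hσ : QInfo.IsDensity σ) hsupp => QInfo.binary_test_le P.norm_φ P.mixed_φ P.dec
      P.posSemidef_received
      P.trace_refProj_kronecker_mul_received hσ hsupp hF hf h1 h2
  refine ⟨fun lam h1 h2 => ?_, fun s h1 h2 => ?_⟩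
  · refine le_iInf₂ fun σ hσ => ?_
    refine QInfo.binaryDiv_le_renyiDiv h1 (inv_pos.2 hcard) hF hF1 fun hsupp => ?_
    rw [one_div, inv_inv]
    exact test lam h1 h2 σ hσ hsupp
  · have hs1 : 0 < s + 1 := by linarith
    -- The order lam = 1/(s+1) carries [-1/2, 0) onto (1, 2].
    have hl1 : 1 < 1 / (s + 1) := by rw [lt_div_iff₀ hs1]; linarith
    have hl2 : 1 / (s + 1) ≤ 2 := by rw [div_le_iff₀ hs1]; linarith
    obtain ⟨hc, σ, hσ, hsupp, heq⟩ := QInfo.exists_density_trace_eq P.posSemidef_received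
      (by rw [P.trace_received, Complex.one_re]; exact one_pos) hl1
    have key := test _ hl1 hl2 σ hσ hsupp
    rw [heq] at key
    rw [one_div_one_div] at hc key
    set c := (QInfo.mpow (QInfo.traceFst (QInfo.mpow P.received (1 / (s + 1)))) (s + 1)).trace.re with hcdef
    have hE : QInfo.gallagerE0 s (QInfo.tensorPower n N.map) P.encoded = -Real.log c := rfl
    have hcard1 : (1 : ℝ) ≤ Fintype.card S := by exact_mod_cast Fintype.card_pos
    have hinv : (Fintype.card S : ℝ)⁻¹ ≤ 1 := inv_le_one_of_one_le₀ hcard1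
    have hnn : 0 ≤ (1 - F) ^ (1 / (s + 1)) *
        ((Fintype.card S : ℝ) - (Fintype.card S : ℝ)⁻¹) ^ (1 - 1 / (s + 1)) :=
      mul_nonneg (Real.rpow_nonneg (by linarith) _) (Real.rpow_nonneg (by linarith) _)
    have h3 : F ^ (1 / (s + 1)) * ((Fintype.card S : ℝ)⁻¹) ^ (1 - 1 / (s + 1)) ≤
        c ^ (1 / (s + 1)) := by linarith
    have h4 := Real.log_le_log (by positivity) h3
    rw [Real.log_mul (by positivity) (by positivity), Real.log_rpow hF0, Real.log_rpow hc,
      Real.log_rpow (inv_pos.2 hcard), Real.log_inv, ← hnR] at h4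
    rw [hE, ← Real.log_le_iff_le_exp hF0]
    -- Multiplying by s + 1 = 1/lam turns the exponent 1 - lam into s.
    have h5 : (s + 1) * (1 / (s + 1) * Real.log F + (1 - 1 / (s + 1)) * -(n * R)) ≤
        (s + 1) * (1 / (s + 1) * Real.log c) := mul_le_mul_of_nonneg_left h4 hs1.le
    have h6 : (s + 1) * (1 / (s + 1)) = 1 := mul_one_div_cancel hs1.ne'
    have h7 : (s + 1) * (1 / (s + 1) * Real.log F + (1 - 1 / (s + 1)) * -(n * R)) =
        Real.log F - s * n * R := by
      linear_combination (Real.log F + n * R) * h6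
    have h8 : (s + 1) * (1 / (s + 1) * Real.log c) = Real.log c := by
      linear_combination Real.log c * h6
    linarith
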